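/- All logarithms are to base 2. Let $\mathcal H_A,\mathcal H_B$ be finite-dimensional complex Hilbert spaces (with fixed orthonormal bases, so that operators are matrices) and let $\rho_{AB}$ be a state, i.e. a positive semidefinite operator of trace one, on $\mathcal H_A\otimes\mathcal H_B$. Write $H(X)_\rho=-\mathrm{tr}[\rho_X\log\rho_X]$ for the von Neumann entropy of the reduced state $\rho_X$, and $I(A:B)_\rho=H(A)_\rho+H(B)_\rho-H(AB)_\rho$. For $n\in\mathbb N$ let $$\mathcal T_n=\{\sigma_{A^n}\otimes\sigma_{B^n} : \sigma_{A^n}\text{ a state on }\mathcal H_A^{\otimes n},\ \sigma_{B^n}\text{ a state on }\mathcal H_B^{\otimes n},\ \text{at least one of them permutation invariant}\},$$ where a state $\sigma$ on $\mathcal H^{\otimes n}$ is permutation invariant if $U(\pi)\sigma U(\pi)^\dagger=\sigma$ for all $\pi\in S_n$, with $U(\pi)$ the unitary permuting the $n$ tensor factors. For $n\geq1$ and $\varepsilon\in(0,1)$ let $$\zeta^n_{A:B}(\varepsilon)=-\frac1n\log\ \inf_{\substack{0\le M\le 1\\ \mathrm{tr}[M\rho_{AB}^{\otimes n}]\ge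 1-\varepsilon}}\ \sup_{\sigma_{A^n}\otimes\sigma_{B^n}\in\mathcal T_n}\mathrm{tr}\big[M(\sigma_{A^n}\otimes\sigma_{B^n})\big],$$ where $M$ ranges over operators on $(\mathcal H_A\otimes\mathcal H_B)^{\otimes n}\cong\mathcal H_A^{\otimes n}\otimes\mathcal H_B^{\otimes n}$. **Proposition.** For every $\varepsilon\in(0,1)$ the limit $\zeta_{A:B}(\varepsilon)=\lim_{n\to\infty}\zeta^n_{A:B}(\varepsilon)$ exists and is finite, and $$\zeta_{A:B}(0):=\lim_{\varepsilon\to0^+}\zeta_{A:B}(\varepsilon)=I(A:B)_\rho .$$ -/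

import Mathlib

open Filter Topology Matrix
open scoped ComplexOrder

noncomputable section

namespace QuantumTesting

/-- Quantum states (density matrices): positive semidefinite matrices of trace one. -/
def IsState {ι : Type*} [Fintype ι] (ρ : Matrix ι ι ℂ) : Prop :=
  ρ.PosSemidef ∧ ρ.trace = 1

/-- The reduced state on `A`, i.e. the partial trace over `B`. -/
def reducedA {a b : Type*} [Fintype b] (ρ : Matrix (a × b) (a × b) ℂ) : Matrix a a ℂ :=
  Matrix.of fun i j => ∑ k, ρ (i, k) (j, k)

/-- The reduced state on `B`, i.e. the partial trace over `A`. -/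
def reducedB {a b : Type*} [Fintype a] (ρ : Matrix (a × b) (a × b) ℂ) : Matrix b b ℂ :=
  Matrix.of fun i j => ∑ k, ρ (k, i) (k, j)

/-- The von Neumann entropy `H(ρ) = - tr[ρ log ρ]`, with the logarithm to base 2. The matrix
logarithm is taken by functional calculus; since `Real.logb 2 0 = 0`, the kernel of `ρ`
contributes zero. -/
def entropy {ι : Type*} [Fintype ι] [DecidableEq ι] (ρ : Matrix ι ι ℂ) : ℝ :=
  -(ρ * cfc (Real.logb 2) ρ).trace.re

/-- The quantum mutual information `I(A:B) = H(A) + H(B) - H(AB)`. -/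
def mutualInformation {a b : Type*} [Fintype a] [DecidableEq a] [Fintype b] [DecidableEq b]
    (ρ : Matrix (a × b) (a × b) ℂ) : ℝ :=
  entropy (reducedA ρ) + entropy (reducedB ρ) - entropy ρ

/-- The tensor power `ρ^{⊗ n}`, where the `n`-fold tensor power of `ℂ^ι` has the product basis
indexed by `Fin n → ι`. -/
def tensorPower {ι : Type*} (ρ : Matrix ι ι ℂ) (n : ℕ) : Matrix (Fin n → ι) (Fin n → ι) ℂ :=
  Matrix.of fun x y => ∏ i, ρ (x i) (y i)

/-- The tensor product `σ ⊗ τ` of an operator on `A^n` and an operator on `B^n`, as an operator on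
`(AB)^n`. -/
def tensorAB {a b : Type*} {n : ℕ} (σ : Matrix (Fin n → a) (Fin n → a) ℂ)
    (τ : Matrix (Fin n → b) (Fin n → b) ℂ) :
    Matrix (Fin n → a × b) (Fin n → a × b) ℂ :=
  Matrix.of fun x y =>
    σ (fun i => (x i).1) (fun i => (y i).1) * τ (fun i => (x i).2) (fun i => (y i).2)

/-- The unitary that permutes the `n` tensor factors: it maps the basis vector `y` to
`y ∘ π⁻¹`. -/
def permUnitary {ι : Type*} [DecidableEq ι] {n : ℕ} (π : Equiv.Perm (Fin n)) :
    Matrix (Fin n → ι) (Fin n → ι) ℂ :=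
  Matrix.of fun x y => if x = y ∘ π.symm then 1 else 0

/-- Permutation invariance: `U(π) σ U(π)† = σ` for all permutations `π` of the tensor factors. -/
def IsPermInvariant {ι : Type*} [Fintype ι] [DecidableEq ι] {n : ℕ}
    (σ : Matrix (Fin n → ι) (Fin n → ι) ℂ) : Prop :=
  ∀ π : Equiv.Perm (Fin n), permUnitary π * σ * (permUnitary π)ᴴ = σ

/-- The alternative hypothesis: product states `σ_{A^n} ⊗ σ_{B^n}` such that at least one of the
two factors is permutation invariant. -/
def alternatives (a b : Type*) [Fintype a] [DecidableEq a] [Fintype b] [DecidableEq b] (n : ℕ) :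
    Set (Matrix (Fin n → a × b) (Fin n → a × b) ℂ) :=
  {ω | ∃ (σ : Matrix (Fin n → a) (Fin n → a) ℂ) (τ : Matrix (Fin n → b) (Fin n → b) ℂ),
    IsState σ ∧ IsState τ ∧ (IsPermInvariant σ ∨ IsPermInvariant τ) ∧ ω = tensorAB σ τ}

/-- The tests `0 ≤ M ≤ 1` on `(AB)^n` with type 1 error at most `ε`, i.e.
`tr[M ρ^{⊗ n}] ≥ 1 - ε`. -/
def tests {a b : Type*} [Fintype a] [DecidableEq a] [Fintype b] [DecidableEq b]
    (ρ : Matrix (a × b) (a × b) ℂ) (n : ℕ) (ε : ℝ) :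
    Set (Matrix (Fin n → a × b) (Fin n → a × b) ℂ) :=
  {M | M.PosSemidef ∧ (1 - M).PosSemidef ∧ 1 - ε ≤ (M * tensorPower ρ n).trace.re}

/-- The worst-case type 2 error of the test `M` over the alternative hypothesis. For `0 ≤ M ≤ 1`
it is a supremum of numbers in `[0, 1]`. -/
def typeTwoError {a b : Type*} [Fintype a] [DecidableEq a] [Fintype b] [DecidableEq b] {n : ℕ}
    (M : Matrix (Fin n → a × b) (Fin n → a × b) ℂ) : ℝ :=
  sSup ((fun ω => (M * ω).trace.re) '' alternatives a b n)

/-- The `n`-copy error exponent `ζⁿ(ε) = -(1/n) log₂ inf_M sup_ω tr[M ω]`. -/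
def errorExponent {a b : Type*} [Fintype a] [DecidableEq a] [Fintype b] [DecidableEq b]
    (ρ : Matrix (a × b) (a × b) ℂ) (n : ℕ) (ε : ℝ) : ℝ :=
  -(1 / (n : ℝ)) * Real.logb 2 (sInf (typeTwoError '' tests ρ n ε))

end QuantumTesting

end

noncomputable section

namespace QuantumTesting

/-! ### Positivity of traces -/

/-! The exponent tends to `I(A:B)` for every fixed `ε` in `(0, 1)`, so the limit function is
constant and `ε → 0` costs nothing. Two bounds give this.

Achievability (`eventually_exists_test`). Every permutation invariant state lies below one operator
of polynomial trace (`universalMatrix_sub_posSemidef`). Only polynomially many matrix entries of its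
square root are distinct, so Cauchy–Schwarz suffices and no representation theory enters. Discarding
the eigenvalues of this operator above about `2 ^ (-n H(A))` removes a subspace too small to carry
weight under `ρ_A^{⊗n}`; likewise on `B`. Let `Q` be the product of the two cut-offs and `P` the
typical projection of `ρ^{⊗n}`. Then `Q P Q` still accepts `ρ^{⊗n}`, while on products of two
invariant states its error is at most about `2 ^ (-n (H(A) + H(B))) tr P`, hence about `2 ^ (-n I)`.
Averaging the test over permutations extends the bound to products with a single invariant factor
(`trace_symmetrize_mul_tensorAB_le`).

Strong converse (`eventually_le_trace_test`). The alternative `ρ_A^{⊗n} ⊗ ρ_B^{⊗n}` alone suffices: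
it dominates about `2 ^ (-n (H(A) + H(B)))` times the product `Q` of the marginal typical
projections, and a test accepting `ρ^{⊗n}` with probability bounded below must have `tr[M Q]` at
least about `2 ^ (n H(AB))`. -/

open scoped MatrixOrder in
theorem trace_mul_re_nonneg {κ : Type*} [Fintype κ] [DecidableEq κ] {A B : Matrix κ κ ℂ}
    (hA : A.PosSemidef) (hB : B.PosSemidef) : 0 ≤ (A * B).trace.re := by
  obtain ⟨Y, rfl⟩ := CStarAlgebra.nonneg_iff_eq_star_mul_self.mp hA.nonneg
  rw [Matrix.mul_assoc, Matrix.trace_mul_comm, Matrix.star_eq_conjTranspose]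
  exact (Complex.le_def.mp (hB.mul_mul_conjTranspose_same Y).trace_nonneg).1

theorem trace_mul_re_mono_left {κ : Type*} [Fintype κ] [DecidableEq κ] {A A' B : Matrix κ κ ℂ}
    (hA : (A' - A).PosSemidef) (hB : B.PosSemidef) : (A * B).trace.re ≤ (A' * B).trace.re := by
  have := trace_mul_re_nonneg hA hB
  rwa [Matrix.sub_mul, Matrix.trace_sub, Complex.sub_re, sub_nonneg] at this

theorem trace_mul_re_mono_right {κ : Type*} [Fintype κ] [DecidableEq κ] {A B B' : Matrix κ κ ℂ}
    (hA : A.PosSemidef) (hB : (B' - B).PosSemidef) : (A * B).trace.re ≤ (A * B').trace.re := by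
  rw [Matrix.trace_mul_comm A B, Matrix.trace_mul_comm A B']
  exact trace_mul_re_mono_left hB hA

/-! ### Matrices in diagonalized form -/

/-- The matrix with real eigenvalues `f` in the basis given by the columns of `W`. -/
def unitaryDiag {κ : Type*} [Fintype κ] [DecidableEq κ] (W : Matrix κ κ ℂ) (f : κ → ℝ) :
    Matrix κ κ ℂ :=
  W * diagonal (fun x => (f x : ℂ)) * Wᴴ

section unitaryDiag

variable {κ : Type*} [Fintype κ] [DecidableEq κ] {W : Matrix κ κ ℂ} (f g : κ → ℝ)

theorem unitaryDiag_mul (hW : Wᴴ * W = 1) :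
    unitaryDiag W f * unitaryDiag W g = unitaryDiag W (fun x => f x * g x) := by
  unfold unitaryDiag
  calc _ = W * diagonal (fun x => (f x : ℂ)) * (Wᴴ * W) * diagonal (fun x => (g x : ℂ)) * Wᴴ := by
        simp only [Matrix.mul_assoc]
    _ = _ := by
        rw [hW, Matrix.mul_one, Matrix.mul_assoc W, diagonal_mul_diagonal]
        simp

theorem unitaryDiag_sub (W : Matrix κ κ ℂ) :
    unitaryDiag W f - unitaryDiag W g = unitaryDiag W (fun x => f x - g x) := by
  unfold unitaryDiag
  rw [← Matrix.sub_mul, ← Matrix.mul_sub, diagonal_sub]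
  simp

theorem smul_unitaryDiag (W : Matrix κ κ ℂ) (c : ℝ) :
    (c : ℂ) • unitaryDiag W f = unitaryDiag W (fun x => c * f x) := by
  unfold unitaryDiag
  rw [← Matrix.smul_mul, ← Matrix.mul_smul, ← diagonal_smul]
  congr 3
  ext
  simp

theorem unitaryDiag_one (hW : W * Wᴴ = 1) : unitaryDiag W (fun _ => 1) = 1 := by
  simp [unitaryDiag, hW]

theorem posSemidef_unitaryDiag (W : Matrix κ κ ℂ) (hf : ∀ x, 0 ≤ f x) :
    (unitaryDiag W f).PosSemidef := by
  apply PosSemidef.mul_mul_conjTranspose_same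
  rw [posSemidef_diagonal_iff]
  intro x
  simpa using hf x

theorem conjTranspose_unitaryDiag (W : Matrix κ κ ℂ) :
    (unitaryDiag W f)ᴴ = unitaryDiag W f := by
  simp only [unitaryDiag, conjTranspose_mul, conjTranspose_conjTranspose, diagonal_conjTranspose,
    Matrix.mul_assoc]
  congr 3
  ext
  simp

theorem trace_unitaryDiag (hW : Wᴴ * W = 1) : (unitaryDiag W f).trace = ∑ x, (f x : ℂ) := by
  rw [unitaryDiag, Matrix.trace_mul_comm, ← Matrix.mul_assoc, hW, Matrix.one_mul, trace_diagonal]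

theorem trace_unitaryDiag_re (hW : Wᴴ * W = 1) : (unitaryDiag W f).trace.re = ∑ x, f x := by
  simp [trace_unitaryDiag f hW]

end unitaryDiag

theorem exists_eq_unitaryDiag {κ : Type*} [Fintype κ] [DecidableEq κ] {A : Matrix κ κ ℂ}
    (hA : A.IsHermitian) : ∃ W : Matrix κ κ ℂ, W * Wᴴ = 1 ∧ Wᴴ * W = 1 ∧
      ∀ f : ℝ → ℝ, cfc f A = unitaryDiag W (fun x => f (hA.eigenvalues x)) := by
  refine ⟨hA.eigenvectorUnitary, ?_, ?_, fun f => ?_⟩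
  · exact Unitary.coe_mul_star_self _
  · exact Unitary.coe_star_mul_self _
  · rw [hA.cfc_eq]
    rfl

/-- Passage to classical probability: the eigenvalues form a distribution whose Shannon entropy is
the von Neumann entropy. -/
theorem exists_entropy_eq {ι : Type*} [Fintype ι] [DecidableEq ι] {ρ : Matrix ι ι ℂ}
    (hρ : IsState ρ) : ∃ (W : Matrix ι ι ℂ) (p : ι → ℝ), W * Wᴴ = 1 ∧ Wᴴ * W = 1 ∧
      (∀ x, 0 ≤ p x) ∧ ∑ x, p x = 1 ∧ ρ = unitaryDiag W p ∧
      entropy ρ = -∑ x, p x * Real.logb 2 (p x) := by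
  obtain ⟨W, h1, h2, h3⟩ := exists_eq_unitaryDiag hρ.1.1
  have h4 : ρ = unitaryDiag W hρ.1.1.eigenvalues := by
    rw [← h3 (fun x => x)]
    exact (cfc_id' ℝ ρ hρ.1.1.isSelfAdjoint).symm
  refine ⟨W, hρ.1.1.eigenvalues, h1, h2, hρ.1.eigenvalues_nonneg, ?_, h4, ?_⟩
  · rw [← trace_unitaryDiag_re _ h2, ← h4, hρ.2, Complex.one_re]
  · rw [entropy, h3]
    nth_rewrite 1 [h4]
    rw [unitaryDiag_mul _ _ h2, trace_unitaryDiag_re _ h2]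

/-! ### Tensor powers -/

theorem sum_prod_pi {ι : Type*} [Fintype ι] (n : ℕ) {R : Type*} [CommSemiring R] (f : Fin n → ι → R) :
    ∑ x : Fin n → ι, ∏ i, f i (x i) = ∏ i, ∑ k, f i k := by
  classical
  rw [Finset.prod_univ_sum, Fintype.piFinset_univ]

theorem tensorPower_mul {ι : Type*} [Fintype ι] (n : ℕ) (A B : Matrix ι ι ℂ) :
    tensorPower A n * tensorPower B n = tensorPower (A * B) n := by
  ext x y
  simp only [Matrix.mul_apply, tensorPower, of_apply, ← Finset.prod_mul_distrib]
  exact sum_prod_pi n fun i k => A (x i) k * B k (y i)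

theorem tensorPower_diagonal {ι : Type*} [DecidableEq ι] (n : ℕ) (d : ι → ℂ) :
    tensorPower (diagonal d) n = diagonal fun x => ∏ i, d (x i) := by
  ext x y
  simp only [tensorPower, of_apply]
  by_cases h : x = y
  · simp [h]
  · obtain ⟨i, hi⟩ := Function.ne_iff.mp h
    rw [diagonal_apply_ne _ h]
    exact Finset.prod_eq_zero (Finset.mem_univ i) (diagonal_apply_ne _ hi)

theorem tensorPower_one {ι : Type*} [DecidableEq ι] (n : ℕ) :
    tensorPower (1 : Matrix ι ι ℂ) n = 1 := by
  rw [← diagonal_one, tensorPower_diagonal]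
  simp

theorem tensorPower_conjTranspose {ι : Type*} (n : ℕ) (A : Matrix ι ι ℂ) :
    (tensorPower A n)ᴴ = tensorPower Aᴴ n := by
  ext x y
  simp [tensorPower]

theorem tensorPower_unitaryDiag {ι : Type*} [Fintype ι] [DecidableEq ι] (n : ℕ) (W : Matrix ι ι ℂ) (f : ι → ℝ) :
    tensorPower (unitaryDiag W f) n = unitaryDiag (tensorPower W n) (fun x => ∏ i, f (x i)) := by
  simp only [unitaryDiag, tensorPower_conjTranspose, ← tensorPower_mul, tensorPower_diagonal,
    Complex.ofReal_prod]

theorem isState_tensorPower {ι : Type*} [Fintype ι] [DecidableEq ι] {ρ : Matrix ι ι ℂ}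
    (hρ : IsState ρ) (n : ℕ) : IsState (tensorPower ρ n) := by
  constructor
  · obtain ⟨W, p, -, -, h0, -, h, -⟩ := exists_entropy_eq hρ
    rw [h, tensorPower_unitaryDiag]
    exact posSemidef_unitaryDiag _ _ fun x => Finset.prod_nonneg fun i _ => h0 _
  · have := sum_prod_pi n fun _ k => ρ k k
    simp only [Matrix.trace, diag_apply, tensorPower, of_apply, this]
    have h2 : ∑ k, ρ k k = 1 := hρ.2
    simp [h2]

/-! ### Typical sequences -/

section typical

variable {ι : Type*} [Fintype ι] {p : ι → ℝ}

/-- Mean and variance of a sum of `n` independent centred variables: on splitting off the first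
letter, the cross term vanishes. -/
theorem sum_pi_mul_sum (h1 : ∑ x, p x = 1) {f : ι → ℝ} (hf : ∑ x, p x * f x = 0) (n : ℕ) :
    ∑ x : Fin n → ι, (∏ i, p (x i)) * ∑ i, f (x i) = 0 ∧
    ∑ x : Fin n → ι, (∏ i, p (x i)) * (∑ i, f (x i)) ^ 2 = n * ∑ x, p x * f x ^ 2 := by
  classical
  have hsum : ∀ n : ℕ, ∑ x : Fin n → ι, ∏ i, p (x i) = 1 := fun n => by
    rw [sum_prod_pi n fun _ k => p k]
    simp [h1]
  induction n with
  | zero => simp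
  | succ n ih =>
    have split : ∀ F : (Fin (n + 1) → ι) → ℝ, ∑ x, F x = ∑ k, ∑ y : Fin n → ι, F (Fin.cons k y) :=
      fun F => by
        rw [← (Fin.consEquiv fun _ => ι).sum_comp, Fintype.sum_prod_type]
        rfl
    constructor
    · rw [split]
      simp only [Fin.prod_univ_succ, Fin.sum_univ_succ, Fin.cons_zero, Fin.cons_succ]
      calc _ = ∑ k, (p k * f k * (∑ y : Fin n → ι, ∏ i, p (y i)) +
            p k * ∑ y : Fin n → ι, (∏ i, p (y i)) * ∑ i, f (y i)) := by
              refine Finset.sum_congr rfl fun k _ => ?_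
              rw [Finset.mul_sum, Finset.mul_sum, ← Finset.sum_add_distrib]
              refine Finset.sum_congr rfl fun y _ => ?_
              ring
        _ = 0 := by simp [hsum, ih.1, hf]
    · rw [split]
      simp only [Fin.prod_univ_succ, Fin.sum_univ_succ, Fin.cons_zero, Fin.cons_succ]
      calc _ = ∑ k, (p k * f k ^ 2 * (∑ y : Fin n → ι, ∏ i, p (y i)) +
            2 * p k * f k * (∑ y : Fin n → ι, (∏ i, p (y i)) * ∑ i, f (y i)) +
            p k * ∑ y : Fin n → ι, (∏ i, p (y i)) * (∑ i, f (y i)) ^ 2) := by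
              refine Finset.sum_congr rfl fun k _ => ?_
              rw [Finset.mul_sum, Finset.mul_sum, Finset.mul_sum, ← Finset.sum_add_distrib,
                ← Finset.sum_add_distrib]
              refine Finset.sum_congr rfl fun y _ => ?_
              ring
        _ = _ := by
              simp only [hsum, ih.1, ih.2, Finset.sum_add_distrib, ← Finset.sum_mul, h1]
              push_cast
              ring

/-- Asymptotic equipartition: the sequences whose probability is not within a factor `2 ^ (n δ)` of
`2 ^ (-n H)` have vanishing total probability. -/
theorem eventually_typical [DecidableEq ι] (h0 : ∀ x, 0 ≤ p x) (h1 : ∑ x, p x = 1) {H δ η : ℝ}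
    (hH : H = -∑ x, p x * Real.logb 2 (p x)) (hδ : 0 < δ) (hη : 0 < η) :
    ∀ᶠ n : ℕ in atTop, ∃ S : Finset (Fin n → ι),
      (∀ x ∈ S, (2 : ℝ) ^ (-(n * (H + δ))) ≤ ∏ i, p (x i) ∧
        ∏ i, p (x i) ≤ (2 : ℝ) ^ (-(n * (H - δ)))) ∧
      ∑ x ∈ Sᶜ, ∏ i, p (x i) ≤ η := by
  classical
  set f : ι → ℝ := fun x => Real.logb 2 (p x) + H with hf
  have hf0 : ∑ x, p x * f x = 0 := by
    simp only [hf, mul_add, Finset.sum_add_distrib, ← Finset.sum_mul, h1]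
    rw [hH]
    ring
  set V := ∑ x, p x * f x ^ 2
  have hlim : Tendsto (fun n : ℕ => V / δ ^ 2 / n) atTop (𝓝 0) :=
    tendsto_const_div_atTop_nhds_zero_nat _
  filter_upwards [hlim.eventually_le_const hη, eventually_gt_atTop 0] with n hn hn0
  have hn0' : (0 : ℝ) < n := by exact_mod_cast hn0
  -- Letters of probability zero are excluded separately, since `Real.logb 2 0 = 0` would let them
  -- pass the deviation test. The rest is Chebyshev's inequality.
  refine ⟨Finset.univ.filter fun x => (∀ i, p (x i) ≠ 0) ∧ |∑ i, f (x i)| ≤ n * δ, ?_, ?_⟩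
  · intro x hx
    obtain ⟨hx, hxs⟩ := (Finset.mem_filter.mp hx).2
    have hpos : 0 < ∏ i, p (x i) :=
      Finset.prod_pos fun i _ => lt_of_le_of_ne (h0 _) (hx i).symm
    have hlog : ∑ i, f (x i) = Real.logb 2 (∏ i, p (x i)) + n * H := by
      rw [Real.logb_prod _ _ fun i _ => hx i]
      simp [hf, Finset.sum_add_distrib]
    rw [hlog, abs_le] at hxs
    rw [← Real.le_logb_iff_rpow_le (by norm_num) hpos,
      ← Real.logb_le_iff_le_rpow (by norm_num) hpos]
    constructor <;> linarith
  · calc _ ≤ ∑ x : Fin n → ι, (∏ i, p (x i)) * (∑ i, f (x i)) ^ 2 / (n * δ) ^ 2 := by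
          refine (Finset.sum_le_sum fun x hx => ?_).trans
            (Finset.sum_le_univ_sum_of_nonneg fun x => ?_)
          · have hP : 0 ≤ ∏ i, p (x i) := Finset.prod_nonneg fun i _ => h0 _
            rw [Finset.mem_compl, Finset.mem_filter, not_and, not_and_or] at hx
            rcases hx (Finset.mem_univ x) with hx | hx
            · push Not at hx
              obtain ⟨i, hi⟩ := hx
              rw [Finset.prod_eq_zero (Finset.mem_univ i) hi]
              simp
            · rw [mul_div_assoc]
              refine le_mul_of_one_le_right hP ?_
              rw [one_le_div (by positivity), ← sq_abs (∑ i, f (x i))]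
              exact pow_le_pow_left₀ (by positivity) (not_le.mp hx).le 2
          · have hP : 0 ≤ ∏ i, p (x i) := Finset.prod_nonneg fun i _ => h0 _
            positivity
      _ = V / δ ^ 2 / n := by
          rw [← Finset.sum_div, (sum_pi_mul_sum h1 hf0 n).2]
          change (n * V) / (n * δ) ^ 2 = _
          field_simp
      _ ≤ η := hn

end typical

/-! ### Projections -/

/-- Orthogonal projections, as matrices. -/
def IsProjection {κ : Type*} [Fintype κ] (P : Matrix κ κ ℂ) : Prop :=
  Pᴴ = P ∧ P * P = P

theorem IsProjection.posSemidef {κ : Type*} [Fintype κ] {P : Matrix κ κ ℂ}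
    (hP : IsProjection P) : P.PosSemidef := by
  have := posSemidef_conjTranspose_mul_self P
  rwa [hP.1, hP.2] at this

theorem IsProjection.one_sub {κ : Type*} [Fintype κ] [DecidableEq κ] {P : Matrix κ κ ℂ}
    (hP : IsProjection P) : IsProjection (1 - P) := by
  constructor
  · rw [conjTranspose_sub, hP.1, conjTranspose_one]
  · rw [Matrix.sub_mul, Matrix.mul_sub, Matrix.mul_sub, hP.2]
    simp

theorem isProjection_unitaryDiag {κ : Type*} [Fintype κ] [DecidableEq κ] {W : Matrix κ κ ℂ}
    (hW : Wᴴ * W = 1) (S : Finset κ) :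
    IsProjection (unitaryDiag W fun x => if x ∈ S then 1 else 0) := by
  refine ⟨conjTranspose_unitaryDiag _ _, ?_⟩
  rw [unitaryDiag_mul _ _ hW]
  congr 1
  ext x
  simp

theorem smul_one_sub_posSemidef_trace {κ : Type*} [Fintype κ] [DecidableEq κ] {M : Matrix κ κ ℂ}
    (hM : M.PosSemidef) {A R : Matrix κ κ ℂ} {t : ℝ} (hA : ((t : ℂ) • 1 - (A - R)).PosSemidef) :
    (M * A).trace.re ≤ t * M.trace.re + (M * R).trace.re := by
  have := trace_mul_re_mono_right hM hA
  simp only [Matrix.mul_sub, Matrix.trace_sub, Matrix.mul_smul, Matrix.mul_one, trace_smul,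
    Complex.sub_re, smul_eq_mul, Complex.re_ofReal_mul] at this
  linarith

/-- The typical projection of many copies of a state. -/
theorem eventually_exists_typical_projection {ι : Type*} [Fintype ι] [DecidableEq ι]
    {ρ : Matrix ι ι ℂ} (hρ : IsState ρ) {δ η : ℝ} (hδ : 0 < δ) (hη : 0 < η) :
    ∀ᶠ n : ℕ in atTop, ∃ P : Matrix (Fin n → ι) (Fin n → ι) ℂ, IsProjection P ∧
      ((1 - P) * tensorPower ρ n).trace.re ≤ η ∧
      P.trace.re ≤ (2 : ℝ) ^ (n * (entropy ρ + δ)) ∧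
      (tensorPower ρ n - (((2 : ℝ) ^ (-(n * (entropy ρ + δ))) : ℝ) : ℂ) • P).PosSemidef ∧
      ∀ M : Matrix (Fin n → ι) (Fin n → ι) ℂ, M.PosSemidef → (1 - M).PosSemidef →
        (M * tensorPower ρ n).trace.re ≤ (2 : ℝ) ^ (-(n * (entropy ρ - δ))) * M.trace.re + η := by
  obtain ⟨W, p, hW1, hW2, h0, h1, rfl, hH⟩ := exists_entropy_eq hρ
  filter_upwards [eventually_typical h0 h1 hH hδ hη] with n ⟨S, hS, hSη⟩
  have hstate := isState_tensorPower hρ n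
  set H := entropy (unitaryDiag W p)
  set Wn := tensorPower W n
  have hWn1 : Wn * Wnᴴ = 1 := by
    rw [tensorPower_conjTranspose, tensorPower_mul, hW1, tensorPower_one]
  have hWn2 : Wnᴴ * Wn = 1 := by
    rw [tensorPower_conjTranspose, tensorPower_mul, hW2, tensorPower_one]
  rw [tensorPower_unitaryDiag] at hstate ⊢
  have hp0 : ∀ x : Fin n → ι, 0 ≤ ∏ i, p (x i) := fun x => Finset.prod_nonneg fun i _ => h0 _
  have hP := isProjection_unitaryDiag hWn2 S
  have h3 : (unitaryDiag Wn (fun x => ∏ i, p (x i)) - (((2 : ℝ) ^ (-(n * (H + δ))) : ℝ) : ℂ) •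
      unitaryDiag Wn fun x => if x ∈ S then 1 else 0).PosSemidef := by
    rw [smul_unitaryDiag, unitaryDiag_sub]
    refine posSemidef_unitaryDiag _ _ fun x => ?_
    by_cases hx : x ∈ S
    · simpa [hx] using (hS x hx).1
    · simpa [hx] using hp0 x
  have hcompl : ∑ x, (1 - if x ∈ S then (1 : ℝ) else 0) * ∏ i, p (x i) =
      ∑ x ∈ Sᶜ, ∏ i, p (x i) := by
    rw [← Finset.sum_subset (Finset.subset_univ Sᶜ)]
    · refine Finset.sum_congr rfl fun x hx => ?_
      rw [if_neg (Finset.mem_compl.mp hx)]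
      ring
    · intro x _ hx
      rw [Finset.mem_compl, not_not] at hx
      rw [if_pos hx]
      ring
  refine ⟨_, hP, ?_, ?_, h3, ?_⟩
  · rw [← unitaryDiag_one hWn1, unitaryDiag_sub, unitaryDiag_mul _ _ hWn2,
      trace_unitaryDiag_re _ hWn2, hcompl]
    exact hSη
  -- Taking traces in `2 ^ (-n (H + δ)) P ≤ ρ^{⊗n}` bounds the rank of `P`.
  · have := (Complex.le_def.mp h3.trace_nonneg).1
    rw [Matrix.trace_sub, hstate.2, trace_smul, smul_eq_mul, Complex.sub_re,
      Complex.re_ofReal_mul, Complex.zero_re, Complex.one_re, sub_nonneg,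
      Real.rpow_neg (by norm_num)] at this
    rwa [inv_mul_le_iff₀ (by positivity), mul_one] at this
  · intro M hM hM1
    -- `R` is the atypical part of `ρ^{⊗n}`: its trace is at most `η`, and what remains is at most
    -- `2 ^ (-n (H - δ))` times the identity.
    set R := unitaryDiag Wn fun x => (1 - if x ∈ S then (1 : ℝ) else 0) * ∏ i, p (x i)
    have hR : R.PosSemidef := by
      refine posSemidef_unitaryDiag _ _ fun x => mul_nonneg ?_ (hp0 x)
      split_ifs <;> norm_num
    have hMR : (M * R).trace.re ≤ η := by
      refine (trace_mul_re_mono_left hM1 hR).trans ?_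
      rw [Matrix.one_mul, trace_unitaryDiag_re _ hWn2, hcompl]
      exact hSη
    have key : ((((2 : ℝ) ^ (-(n * (H - δ))) : ℝ) : ℂ) • 1 -
        (unitaryDiag Wn (fun x => ∏ i, p (x i)) - R)).PosSemidef := by
      rw [← unitaryDiag_one hWn1, smul_unitaryDiag, unitaryDiag_sub, unitaryDiag_sub]
      refine posSemidef_unitaryDiag _ _ fun x => ?_
      by_cases hx : x ∈ S
      · simpa [hx] using (hS x hx).2
      · simp only [hx, if_false]
        ring_nf
        positivity
    linarith [smul_one_sub_posSemidef_trace hM key]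

/-- Markov's inequality for eigenvalues: `Q` keeps those at most `t`, and each discarded one
contributes more than `t` to the trace. -/
theorem exists_spectral_projection {κ : Type*} [Fintype κ] [DecidableEq κ] {Ω : Matrix κ κ ℂ}
    (hΩ : Ω.PosSemidef) {t : ℝ} (ht : 0 < t) :
    ∃ Q : Matrix κ κ ℂ, IsProjection Q ∧ ((t : ℂ) • 1 - Q * Ω * Q).PosSemidef ∧
      (1 - Q).trace.re ≤ Ω.trace.re / t := by
  obtain ⟨W, hW1, hW2, h3⟩ := exists_eq_unitaryDiag hΩ.1
  set l := hΩ.1.eigenvalues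
  have hl : ∀ x, 0 ≤ l x := hΩ.eigenvalues_nonneg
  have h4 : Ω = unitaryDiag W l := by
    rw [← h3 (fun x => x)]
    exact (cfc_id' ℝ Ω hΩ.1.isSelfAdjoint).symm
  refine ⟨_, isProjection_unitaryDiag hW2 (Finset.univ.filter fun x => l x ≤ t), ?_, ?_⟩
  · rw [h4, unitaryDiag_mul _ _ hW2, unitaryDiag_mul _ _ hW2, ← unitaryDiag_one hW1,
      smul_unitaryDiag, unitaryDiag_sub]
    refine posSemidef_unitaryDiag _ _ fun x => ?_
    by_cases hx : l x ≤ t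
    · simp [hx]
    · simpa [hx] using ht.le
  · rw [← unitaryDiag_one hW1, unitaryDiag_sub, trace_unitaryDiag_re _ hW2, h4,
      trace_unitaryDiag_re _ hW2, Finset.sum_div]
    refine Finset.sum_le_sum fun x _ => ?_
    by_cases hx : l x ≤ t
    · simpa [hx] using div_nonneg (hl x) ht.le
    · simpa [hx] using (one_le_div ht).mpr (not_le.mp hx).le

/-! ### Permutation invariance -/

theorem commute_cfc {κ : Type*} [Fintype κ] [DecidableEq κ] {A U : Matrix κ κ ℂ}
    (h : Commute A U) (f : ℝ → ℝ) : Commute (cfc f A) U :=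
  h.cfc_real f

theorem mul_cfc_mul_conjTranspose {κ : Type*} [Fintype κ] [DecidableEq κ] {A U : Matrix κ κ ℂ}
    (hU : Uᴴ * U = 1) (h : U * A * Uᴴ = A) (f : ℝ → ℝ) : U * cfc f A * Uᴴ = cfc f A := by
  have hc : Commute A U := by
    have := congrArg (· * U) h
    simp only [Matrix.mul_assoc, hU, Matrix.mul_one] at this
    exact this.symm
  rw [← (commute_cfc hc f).eq, Matrix.mul_assoc, mul_eq_one_comm.mp hU, Matrix.mul_one]

section perm

variable {ι : Type*} [Fintype ι] [DecidableEq ι] {n : ℕ}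

theorem permUnitary_conj (π : Equiv.Perm (Fin n)) (σ : Matrix (Fin n → ι) (Fin n → ι) ℂ) :
    permUnitary π * σ * (permUnitary π)ᴴ = σ.submatrix (fun x => x ∘ π) (fun x => x ∘ π) := by
  have h : ∀ x y : Fin n → ι, x = y ∘ π.symm ↔ x ∘ π = y := fun x y => by
    rw [Equiv.eq_comp_symm]
  ext x y
  simp [Matrix.mul_apply, permUnitary, h]

theorem isPermInvariant_iff {σ : Matrix (Fin n → ι) (Fin n → ι) ℂ} : IsPermInvariant σ ↔
    ∀ π : Equiv.Perm (Fin n), σ.submatrix (fun x => x ∘ π) (fun x => x ∘ π) = σ := by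
  simp only [IsPermInvariant, permUnitary_conj]

theorem permUnitary_conj_self (π : Equiv.Perm (Fin n)) :
    (permUnitary π : Matrix (Fin n → ι) (Fin n → ι) ℂ)ᴴ * permUnitary π = 1 := by
  rw [mul_eq_one_comm]
  have := permUnitary_conj π (1 : Matrix (Fin n → ι) (Fin n → ι) ℂ)
  rw [Matrix.mul_one] at this
  rw [this]
  exact submatrix_one _ fun x y h => by
    funext i
    simpa using congrFun h (π.symm i)

theorem isPermInvariant_cfc {σ : Matrix (Fin n → ι) (Fin n → ι) ℂ} (h : IsPermInvariant σ)
    (f : ℝ → ℝ) : IsPermInvariant (cfc f σ) :=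
  fun π => mul_cfc_mul_conjTranspose (permUnitary_conj_self π) (h π) f

/-! ### Types of pairs of sequences and the universal symmetric operator -/

/-- The type of a pair of sequences: the number of occurrences of each pair of letters. -/
def pairType {ι : Type*} [DecidableEq ι] {n : ℕ} (x y : Fin n → ι) (k : ι × ι) : Fin (n + 1) :=
  ⟨(Finset.univ.filter fun i => (x i, y i) = k).card,
    Nat.lt_succ_of_le ((Finset.card_le_univ _).trans (Fintype.card_fin n).le)⟩

/-- Equal types mean that `i ↦ (x i, y i)` and `i ↦ (x' i, y' i)` have fibres of equal size;
bijections between the fibres glue to a permutation. -/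
theorem exists_perm_of_pairType_eq {ι : Type*} [DecidableEq ι] {n : ℕ} {x y x' y' : Fin n → ι} (h : pairType x y = pairType x' y') :
    ∃ π : Equiv.Perm (Fin n), x = x' ∘ π ∧ y = y' ∘ π := by
  have e : ∀ k, {i // (x i, y i) = k} ≃ {i // (x' i, y' i) = k} := fun k => by
    refine Fintype.equivOfCardEq ?_
    rw [Fintype.card_subtype, Fintype.card_subtype]
    exact congrArg Fin.val (congrFun h k)
  have hπ := Equiv.ofFiberEquiv_map (f := fun i => (x i, y i)) (g := fun i => (x' i, y' i)) e
  refine ⟨Equiv.ofFiberEquiv e, ?_, ?_⟩ <;> funext i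
  · exact (congrArg Prod.fst (hπ i)).symm
  · exact (congrArg Prod.snd (hπ i)).symm

/-- The indicator matrix of the pairs of sequences of a given type. -/
def typeIndicator (t : ι × ι → Fin (n + 1)) : Matrix (Fin n → ι) (Fin n → ι) ℂ :=
  Matrix.of fun x y => if pairType x y = t then 1 else 0

/-- The number of pairs of sequences of a given type. -/
def typeCount (t : ι × ι → Fin (n + 1)) : ℝ :=
  ∑ x : Fin n → ι, ∑ y : Fin n → ι, if pairType x y = t then 1 else 0

theorem typeCount_nonneg (t : ι × ι → Fin (n + 1)) : 0 ≤ typeCount t :=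
  Finset.sum_nonneg fun x _ => Finset.sum_nonneg fun y _ => by split_ifs <;> norm_num

theorem typeCount_pos (x y : Fin n → ι) : 0 < typeCount (pairType x y) := by
  have h0 : ∀ x' y' : Fin n → ι, (0 : ℝ) ≤ if pairType x' y' = pairType x y then 1 else 0 :=
    fun x' y' => by split_ifs <;> norm_num
  calc (0 : ℝ) < if pairType x y = pairType x y then 1 else 0 := by simp
    _ ≤ ∑ y', if pairType x y' = pairType x y then 1 else 0 :=
        Finset.single_le_sum (f := fun y' => if pairType x y' = pairType x y then (1 : ℝ) else 0)
          (fun y' _ => h0 x y') (Finset.mem_univ y)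
    _ ≤ _ := Finset.single_le_sum
          (f := fun x' => ∑ y', if pairType x' y' = pairType x y then (1 : ℝ) else 0)
          (fun x' _ => Finset.sum_nonneg fun y' _ => h0 x' y') (Finset.mem_univ x)

theorem sum_mul_ite_pairType (x y : Fin n → ι) (g : (ι × ι → Fin (n + 1)) → ℂ) :
    ∑ t, g t * typeIndicator t x y = g (pairType x y) := by
  simp [typeIndicator]

/-- The universal symmetric operator: up to the factor `(n + 1) ^ (d ^ 2)` bounding its trace, it is
a state that dominates all permutation invariant states. -/
def universalMatrix (ι : Type*) [Fintype ι] [DecidableEq ι] (n : ℕ) :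
    Matrix (Fin n → ι) (Fin n → ι) ℂ :=
  ∑ t : ι × ι → Fin (n + 1), (((typeCount t)⁻¹ : ℝ) : ℂ) • ((typeIndicator t)ᴴ * typeIndicator t)

theorem posSemidef_universalMatrix : (universalMatrix ι n).PosSemidef :=
  posSemidef_sum _ fun t _ => (posSemidef_conjTranspose_mul_self _).smul
    (by exact_mod_cast inv_nonneg.mpr (typeCount_nonneg t))

theorem trace_universalMatrix_le :
    (universalMatrix ι n).trace.re ≤ (n + 1 : ℝ) ^ Fintype.card (ι × ι) := by
  have h : ∀ t : ι × ι → Fin (n + 1),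
      ((typeIndicator t)ᴴ * typeIndicator t).trace = (typeCount t : ℂ) := fun t => by
    simp only [Matrix.trace, diag_apply, Matrix.mul_apply, conjTranspose_apply, typeIndicator,
      of_apply, typeCount]
    rw [Finset.sum_comm]
    push_cast
    refine Finset.sum_congr rfl fun x _ => Finset.sum_congr rfl fun y _ => ?_
    split_ifs <;> simp
  rw [universalMatrix, Matrix.trace_sum, Complex.re_sum]
  calc _ ≤ ∑ t : ι × ι → Fin (n + 1), (1 : ℝ) := by
        refine Finset.sum_le_sum fun t _ => ?_
        rw [trace_smul, h, smul_eq_mul, ← Complex.ofReal_mul, Complex.ofReal_re]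
        -- The bound, rather than equality, covers types that do not occur: there the count and its
        -- inverse are both `0`.
        exact inv_mul_le_one
    _ = _ := by simp

/-- The square root `Y` of `σ` is again invariant, so `Y = ∑ g t E_t` over the type indicators
`E_t`. As `tr[Y† Y] = 1`, the numbers `|g t|²` weighted by the type counts sum to `1`, and
Cauchy–Schwarz bounds `‖Y v‖²` by `∑ ‖E_t v‖² / typeCount t`. -/
theorem universalMatrix_sub_posSemidef {σ : Matrix (Fin n → ι) (Fin n → ι) ℂ} (hσ : IsState σ)
    (hinv : IsPermInvariant σ) : (universalMatrix ι n - σ).PosSemidef := by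
  set Y := cfc Real.sqrt σ with hY
  have hYY : Yᴴ * Y = σ := by
    have hsa : Yᴴ = Y := cfc_predicate (R := ℝ) Real.sqrt σ
    rw [hsa, hY, ← cfc_mul Real.sqrt Real.sqrt σ]
    conv_rhs => rw [← cfc_id' ℝ σ hσ.1.1.isSelfAdjoint]
    refine cfc_congr fun x hx => ?_
    rw [hσ.1.1.spectrum_real_eq_range_eigenvalues] at hx
    obtain ⟨i, rfl⟩ := hx
    exact Real.mul_self_sqrt (hσ.1.eigenvalues_nonneg i)
  have hYinv := isPermInvariant_iff.mp (isPermInvariant_cfc hinv Real.sqrt)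
  rw [← hY] at hYinv
  -- Invariance makes the entries of `Y` constant on each type; `g` reads them off at a chosen
  -- representative.
  obtain ⟨g, hg⟩ : ∃ g : (ι × ι → Fin (n + 1)) → ℂ, ∀ x y, Y x y = g (pairType x y) := by
    classical
    refine ⟨fun t => if h : ∃ z : (Fin n → ι) × (Fin n → ι), pairType z.1 z.2 = t then
      Y h.choose.1 h.choose.2 else 0, fun x y => ?_⟩
    have h : ∃ z : (Fin n → ι) × (Fin n → ι), pairType z.1 z.2 = pairType x y := ⟨(x, y), rfl⟩
    simp only [dif_pos h]
    obtain ⟨π, h1, h2⟩ := exists_perm_of_pairType_eq h.choose_spec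
    rw [h1, h2]
    exact (congrFun (congrFun (hYinv π) x) y).symm
  have hYsum : Y = ∑ t, g t • typeIndicator t := by
    ext x y
    rw [hg, Matrix.sum_apply, ← sum_mul_ite_pairType x y g]
    rfl
  have hnorm : ∑ t, ‖g t‖ ^ 2 * typeCount t = 1 := by
    have h1 : (Yᴴ * Y).trace.re = 1 := by rw [hYY, hσ.2, Complex.one_re]
    rw [← h1]
    simp only [Matrix.trace, diag_apply, Matrix.mul_apply, conjTranspose_apply, hg,
      Complex.re_sum, typeCount, Finset.mul_sum]
    rw [Finset.sum_comm]
    conv_rhs => rw [Finset.sum_comm]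
    refine Finset.sum_congr rfl fun x _ => ?_
    rw [Finset.sum_comm]
    refine Finset.sum_congr rfl fun y _ => ?_
    simp only [if_true, mul_one, mul_ite, mul_zero, Finset.sum_ite_eq, Finset.mem_univ,
      Complex.star_def, ← Complex.normSq_eq_conj_mul_self, Complex.normSq_eq_norm_sq,
      Complex.ofReal_re]
  refine PosSemidef.of_dotProduct_mulVec_nonneg
    (posSemidef_universalMatrix.1.sub hσ.1.1) fun v => ?_
  have hquad : ∀ A : Matrix (Fin n → ι) (Fin n → ι) ℂ,
      star v ⬝ᵥ ((Aᴴ * A) *ᵥ v) = ((∑ x, ‖(A *ᵥ v) x‖ ^ 2 : ℝ) : ℂ) := fun A => by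
    rw [← mulVec_mulVec, dotProduct_mulVec, vecMul_conjTranspose, star_star]
    simp [dotProduct, Complex.conj_mul']
  rw [sub_mulVec, dotProduct_sub, ← hYY, hquad, universalMatrix, sum_mulVec, dotProduct_sum]
  simp only [smul_mulVec, dotProduct_smul, hquad, smul_eq_mul]
  rw [sub_nonneg]
  norm_cast
  simp only [Finset.mul_sum]
  rw [Finset.sum_comm]
  refine Finset.sum_le_sum fun x _ => ?_
  have hYv : (Y *ᵥ v) x = ∑ t, g t * (typeIndicator t *ᵥ v) x := by
    rw [hYsum, sum_mulVec, Finset.sum_apply]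
    simp [smul_mulVec]
  have hzero : ∀ t, typeCount t = 0 → (typeIndicator t *ᵥ v) x = 0 := fun t ht => by
    refine Finset.sum_eq_zero fun y _ => ?_
    have : pairType x y ≠ t := fun h => (typeCount_pos x y).ne' (h ▸ ht)
    simp [typeIndicator, this]
  calc ‖(Y *ᵥ v) x‖ ^ 2 ≤ (∑ t, (‖g t‖ * √(typeCount t)) *
        (‖(typeIndicator t *ᵥ v) x‖ / √(typeCount t))) ^ 2 := by
        refine pow_le_pow_left₀ (norm_nonneg _) ?_ 2
        rw [hYv]
        refine (norm_sum_le _ _).trans (Finset.sum_le_sum fun t _ => ?_)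
        rw [norm_mul]
        rcases (typeCount_nonneg t).eq_or_lt with h | h
        · simp [hzero t h.symm]
        · have : 0 < √(typeCount t) := Real.sqrt_pos.mpr h
          exact le_of_eq (by field_simp)
    _ ≤ (∑ t, (‖g t‖ * √(typeCount t)) ^ 2) *
        ∑ t, (‖(typeIndicator t *ᵥ v) x‖ / √(typeCount t)) ^ 2 :=
        Finset.sum_mul_sq_le_sq_mul_sq _ _ _
    _ = _ := by
        simp only [mul_pow, div_pow, Real.sq_sqrt (typeCount_nonneg _), hnorm, one_mul]
        exact Finset.sum_congr rfl fun t _ => by rw [div_eq_inv_mul]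

/-! ### Averaging over permutations -/

/-- The average of a matrix over all permutations of the tensor factors. -/
def symmetrize (M : Matrix (Fin n → ι) (Fin n → ι) ℂ) : Matrix (Fin n → ι) (Fin n → ι) ℂ :=
  (((n.factorial : ℝ)⁻¹ : ℝ) : ℂ) •
    ∑ π : Equiv.Perm (Fin n), M.submatrix (fun x => x ∘ π) (fun x => x ∘ π)

theorem symmetrize_eq_self {M : Matrix (Fin n → ι) (Fin n → ι) ℂ} (h : IsPermInvariant M) :
    symmetrize M = M := by
  have h0 : (n.factorial : ℂ) ≠ 0 := by exact_mod_cast n.factorial_ne_zero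
  simp only [symmetrize, isPermInvariant_iff.mp h, Finset.sum_const, Finset.card_univ,
    Fintype.card_perm, Fintype.card_fin, ← Nat.cast_smul_eq_nsmul ℂ, smul_smul]
  push_cast
  rw [inv_mul_cancel₀ h0, one_smul]

theorem symmetrize_sub {ι : Type*} {n : ℕ} (M N : Matrix (Fin n → ι) (Fin n → ι) ℂ) :
    symmetrize (M - N) = symmetrize M - symmetrize N := by
  simp only [symmetrize, submatrix_sub, Finset.sum_sub_distrib, Pi.sub_apply, smul_sub]

theorem isPermInvariant_symmetrize (M : Matrix (Fin n → ι) (Fin n → ι) ℂ) :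
    IsPermInvariant (symmetrize M) := by
  rw [isPermInvariant_iff]
  intro π
  ext x y
  simp only [symmetrize, submatrix_apply, Matrix.smul_apply, Matrix.sum_apply]
  congr 1
  exact Equiv.sum_comp (Equiv.mulLeft π) fun κ : Equiv.Perm (Fin n) => M (x ∘ κ) (y ∘ κ)

theorem posSemidef_symmetrize {ι : Type*} {n : ℕ} {M : Matrix (Fin n → ι) (Fin n → ι) ℂ} (hM : M.PosSemidef) :
    (symmetrize M).PosSemidef :=
  (posSemidef_sum _ fun _ _ => hM.submatrix _).smul
    (by exact_mod_cast inv_nonneg.mpr (Nat.cast_nonneg _))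

theorem isPermInvariant_one : IsPermInvariant (1 : Matrix (Fin n → ι) (Fin n → ι) ℂ) := fun π => by
  rw [Matrix.mul_one, mul_eq_one_comm.mp (permUnitary_conj_self π)]

theorem isPermInvariant_tensorPower (ρ : Matrix ι ι ℂ) : IsPermInvariant (tensorPower ρ n) := by
  rw [isPermInvariant_iff]
  intro π
  ext x y
  exact Equiv.prod_comp π fun i => ρ (x i) (y i)

theorem trace_submatrix_mul {ι : Type*} [Fintype ι] {n : ℕ} (π : Equiv.Perm (Fin n)) (M N : Matrix (Fin n → ι) (Fin n → ι) ℂ) :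
    (M.submatrix (fun x => x ∘ π) (fun x => x ∘ π) * N).trace =
      (M * N.submatrix (fun x => x ∘ π.symm) (fun x => x ∘ π.symm)).trace := by
  simp only [Matrix.trace, diag_apply, Matrix.mul_apply, submatrix_apply]
  let e : (Fin n → ι) ≃ (Fin n → ι) := Equiv.arrowCongr π (Equiv.refl ι)
  have he : ∀ x, e x ∘ π = x := fun x => by
    ext i
    simp [e]
  rw [← e.sum_comp]
  refine Finset.sum_congr rfl fun x _ => ?_
  rw [← e.sum_comp]
  refine Finset.sum_congr rfl fun y _ => ?_
  rw [he, he]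
  rfl

/-- Averaging is self-adjoint for the trace pairing, because inversion permutes the group; it can
thus be moved from a test to a state. -/
theorem trace_symmetrize_mul {ι : Type*} [Fintype ι] {n : ℕ} (M N : Matrix (Fin n → ι) (Fin n → ι) ℂ) :
    (symmetrize M * N).trace = (M * symmetrize N).trace := by
  simp only [symmetrize, Matrix.smul_mul, Matrix.mul_smul, trace_smul, Matrix.sum_mul,
    Matrix.mul_sum, Matrix.trace_sum, trace_submatrix_mul]
  congr 1
  exact Equiv.sum_comp (Equiv.inv (Equiv.Perm (Fin n))) fun π : Equiv.Perm (Fin n) =>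
    (M * N.submatrix (fun x => x ∘ π) (fun x => x ∘ π)).trace

theorem isState_symmetrize {σ : Matrix (Fin n → ι) (Fin n → ι) ℂ} (hσ : IsState σ) :
    IsState (symmetrize σ) := by
  refine ⟨posSemidef_symmetrize hσ.1, ?_⟩
  rw [← Matrix.mul_one (symmetrize σ), trace_symmetrize_mul,
    symmetrize_eq_self isPermInvariant_one, Matrix.mul_one, hσ.2]

end perm

/-! ### Compression by projections -/

section compression

variable {κ : Type*} [Fintype κ] [DecidableEq κ] {Q X R : Matrix κ κ ℂ}

/-- With `Q' = 1 - Q`, the parallelogram identity `(1 + Q') X (1 + Q') + Q X Q = 2 X + 2 Q' X Q'`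
and `Q' X Q' ≤ Q'`. -/
theorem trace_compress_le (hQ : IsProjection Q) (hX : X.PosSemidef) (hX1 : (1 - X).PosSemidef)
    (hR : R.PosSemidef) :
    (Q * X * Q * R).trace.re ≤ 2 * (X * R).trace.re + 2 * ((1 - Q) * R).trace.re := by
  have h1 := trace_mul_re_nonneg (hX.mul_mul_conjTranspose_same (1 + (1 - Q))) hR
  have h2 := trace_mul_re_nonneg (hX1.mul_mul_conjTranspose_same (1 - Q)) hR
  rw [conjTranspose_add, hQ.one_sub.1, conjTranspose_one] at h1
  rw [hQ.one_sub.1] at h2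
  have e1 : (1 + (1 - Q)) * X * (1 + (1 - Q)) * R =
      X * R + X * R + ((1 - Q) * X * (1 - Q) * R + (1 - Q) * X * (1 - Q) * R) - Q * X * Q * R := by
    noncomm_ring
  have e2 : (1 - Q) * (1 - X) * (1 - Q) * R = (1 - Q) * R - (1 - Q) * X * (1 - Q) * R := by
    rw [Matrix.mul_sub (1 - Q) 1 X, Matrix.mul_one, Matrix.sub_mul, hQ.one_sub.2, Matrix.sub_mul]
  rw [e1] at h1
  rw [e2] at h2
  simp only [Matrix.trace_add, Matrix.trace_sub, Complex.add_re, Complex.sub_re] at h1 h2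
  linarith

/-- With `Q' = 1 - Q`, the identity `X + (Q - Q') X (Q - Q') = 2 Q X Q + 2 Q' X Q'`. -/
theorem trace_le_compress (hQ : IsProjection Q) (hX : X.PosSemidef) (hX1 : (1 - X).PosSemidef)
    (hR : R.PosSemidef) :
    (X * R).trace.re ≤ 2 * (Q * X * Q * R).trace.re + 2 * ((1 - Q) * R).trace.re := by
  have h1 := trace_mul_re_nonneg (hX.mul_mul_conjTranspose_same (Q - (1 - Q))) hR
  have h2 := trace_mul_re_nonneg (hX1.mul_mul_conjTranspose_same (1 - Q)) hR
  rw [conjTranspose_sub, hQ.one_sub.1, hQ.1] at h1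
  rw [hQ.one_sub.1] at h2
  have e1 : (Q - (1 - Q)) * X * (Q - (1 - Q)) * R = Q * X * Q * R + Q * X * Q * R +
      ((1 - Q) * X * (1 - Q) * R + (1 - Q) * X * (1 - Q) * R) - X * R := by
    noncomm_ring
  have e2 : (1 - Q) * (1 - X) * (1 - Q) * R = (1 - Q) * R - (1 - Q) * X * (1 - Q) * R := by
    rw [Matrix.mul_sub (1 - Q) 1 X, Matrix.mul_one, Matrix.sub_mul, hQ.one_sub.2, Matrix.sub_mul]
  rw [e1] at h1
  rw [e2] at h2
  simp only [Matrix.trace_add, Matrix.trace_sub, Complex.add_re, Complex.sub_re] at h1 h2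
  linarith

theorem one_sub_compress_posSemidef (hQ : IsProjection Q) (hX1 : (1 - X).PosSemidef) :
    (1 - Q * X * Q).PosSemidef := by
  have h := hQ.one_sub.posSemidef.add (hX1.mul_mul_conjTranspose_same Q)
  rwa [hQ.1, Matrix.mul_sub, Matrix.sub_mul, Matrix.mul_one, hQ.2, sub_add_sub_cancel] at h

theorem compress_posSemidef {κ : Type*} [Fintype κ] {Q X : Matrix κ κ ℂ} (hQ : IsProjection Q) (hX : X.PosSemidef) :
    (Q * X * Q).PosSemidef := by
  have h := hX.mul_mul_conjTranspose_same Q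
  rwa [hQ.1] at h

end compression

/-! ### Tensor products and reduced states -/

section tensorAB

variable {a b : Type*} [Fintype a] [DecidableEq a] [Fintype b] [DecidableEq b] {n : ℕ}

open scoped Kronecker in
theorem tensorAB_eq_kronecker {a b : Type*} {n : ℕ} (A : Matrix (Fin n → a) (Fin n → a) ℂ)
    (B : Matrix (Fin n → b) (Fin n → b) ℂ) :
    tensorAB A B = (A ⊗ₖ B).submatrix (Equiv.arrowProdEquivProdArrow (Fin n) (fun _ => a)
      fun _ => b) (Equiv.arrowProdEquivProdArrow (Fin n) (fun _ => a) fun _ => b) :=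
  rfl

theorem tensorAB_mul {a b : Type*} [Fintype a] [Fintype b] {n : ℕ} (A A' : Matrix (Fin n → a) (Fin n → a) ℂ)
    (B B' : Matrix (Fin n → b) (Fin n → b) ℂ) :
    tensorAB A B * tensorAB A' B' = tensorAB (A * A') (B * B') := by
  simp only [tensorAB_eq_kronecker, submatrix_mul_equiv, mul_kronecker_mul]

theorem tensorAB_one {a b : Type*} [DecidableEq a] [DecidableEq b] {n : ℕ} :
    tensorAB (1 : Matrix (Fin n → a) (Fin n → a) ℂ) (1 : Matrix (Fin n → b) (Fin n → b) ℂ) = 1 := by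
  simp only [tensorAB_eq_kronecker, one_kronecker_one, submatrix_one_equiv]

theorem tensorAB_conjTranspose {a b : Type*} {n : ℕ} (A : Matrix (Fin n → a) (Fin n → a) ℂ)
    (B : Matrix (Fin n → b) (Fin n → b) ℂ) : (tensorAB A B)ᴴ = tensorAB Aᴴ Bᴴ := by
  ext x y
  simp [tensorAB]

theorem tensorAB_sub_left {a b : Type*} {n : ℕ} (A A' : Matrix (Fin n → a) (Fin n → a) ℂ)
    (B : Matrix (Fin n → b) (Fin n → b) ℂ) :
    tensorAB (A - A') B = tensorAB A B - tensorAB A' B := by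
  ext x y
  simp [tensorAB, sub_mul]

theorem tensorAB_sub_right {a b : Type*} {n : ℕ} (A : Matrix (Fin n → a) (Fin n → a) ℂ)
    (B B' : Matrix (Fin n → b) (Fin n → b) ℂ) :
    tensorAB A (B - B') = tensorAB A B - tensorAB A B' := by
  ext x y
  simp [tensorAB, mul_sub]

theorem tensorAB_smul_smul {a b : Type*} {n : ℕ} (c d : ℂ)
    (A : Matrix (Fin n → a) (Fin n → a) ℂ) (B : Matrix (Fin n → b) (Fin n → b) ℂ) :
    tensorAB (c • A) (d • B) = (c * d) • tensorAB A B := by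
  ext x y
  simp [tensorAB]
  ring

theorem posSemidef_tensorAB {a b : Type*} [Fintype a] [Fintype b] {n : ℕ} {A : Matrix (Fin n → a) (Fin n → a) ℂ}
    {B : Matrix (Fin n → b) (Fin n → b) ℂ} (hA : A.PosSemidef) (hB : B.PosSemidef) :
    (tensorAB A B).PosSemidef := by
  rw [tensorAB_eq_kronecker]
  exact (hA.kronecker hB).submatrix _

theorem isProjection_tensorAB {a b : Type*} [Fintype a] [Fintype b] {n : ℕ}
    {A : Matrix (Fin n → a) (Fin n → a) ℂ}
    {B : Matrix (Fin n → b) (Fin n → b) ℂ} (hA : IsProjection A) (hB : IsProjection B) :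
    IsProjection (tensorAB A B) := by
  constructor
  · rw [tensorAB_conjTranspose, hA.1, hB.1]
  · rw [tensorAB_mul, hA.2, hB.2]

/-- The difference is `(A' - A) ⊗ B' + A ⊗ (B' - B)`. -/
theorem tensorAB_sub_posSemidef {a b : Type*} [Fintype a] [Fintype b] {n : ℕ}
    {A A' : Matrix (Fin n → a) (Fin n → a) ℂ}
    {B B' : Matrix (Fin n → b) (Fin n → b) ℂ} (hA : A.PosSemidef) (hB' : B'.PosSemidef)
    (h : (A' - A).PosSemidef) (h' : (B' - B).PosSemidef) :
    (tensorAB A' B' - tensorAB A B).PosSemidef := by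
  have := (posSemidef_tensorAB h hB').add (posSemidef_tensorAB hA h')
  rwa [tensorAB_sub_left, tensorAB_sub_right, sub_add_sub_cancel] at this

theorem trace_tensorAB_one_mul {a b : Type*} [Fintype a] [Fintype b] [DecidableEq b] {n : ℕ}
    (X : Matrix (Fin n → a) (Fin n → a) ℂ)
    (ρ : Matrix (a × b) (a × b) ℂ) :
    (tensorAB X 1 * tensorPower ρ n).trace = (X * tensorPower (reducedA ρ) n).trace := by
  let e := (Equiv.arrowProdEquivProdArrow (Fin n) (fun _ => a) fun _ => b).symm
  have hT : ∀ x z y w, tensorAB X 1 (e (x, z)) (e (y, w)) =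
      X x y * (1 : Matrix (Fin n → b) (Fin n → b) ℂ) z w := fun _ _ _ _ => rfl
  simp only [Matrix.trace, diag_apply, Matrix.mul_apply]
  rw [← e.sum_comp, Fintype.sum_prod_type]
  refine Finset.sum_congr rfl fun x _ => ?_
  calc _ = ∑ z : Fin n → b, ∑ y : Fin n → a, X x y * ∏ i, ρ (y i, z i) (x i, z i) := by
        refine Finset.sum_congr rfl fun z _ => ?_
        rw [← e.sum_comp, Fintype.sum_prod_type]
        refine Finset.sum_congr rfl fun y _ => ?_
        rw [Finset.sum_eq_single z]
        · rw [hT, one_apply_eq, mul_one]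
          rfl
        · intro w _ hw
          rw [hT, one_apply_ne hw.symm, mul_zero, zero_mul]
        · simp
    _ = _ := by
        rw [Finset.sum_comm]
        refine Finset.sum_congr rfl fun y _ => ?_
        rw [← Finset.mul_sum, sum_prod_pi n fun i k => ρ (y i, k) (x i, k)]
        rfl

theorem trace_one_tensorAB_mul {a b : Type*} [Fintype a] [DecidableEq a] [Fintype b] {n : ℕ}
    (Y : Matrix (Fin n → b) (Fin n → b) ℂ)
    (ρ : Matrix (a × b) (a × b) ℂ) :
    (tensorAB 1 Y * tensorPower ρ n).trace = (Y * tensorPower (reducedB ρ) n).trace := by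
  let e := (Equiv.arrowProdEquivProdArrow (Fin n) (fun _ => a) fun _ => b).symm
  have hT : ∀ z x w y, tensorAB 1 Y (e (z, x)) (e (w, y)) =
      (1 : Matrix (Fin n → a) (Fin n → a) ℂ) z w * Y x y := fun _ _ _ _ => rfl
  simp only [Matrix.trace, diag_apply, Matrix.mul_apply]
  rw [← e.sum_comp, Fintype.sum_prod_type, Finset.sum_comm]
  refine Finset.sum_congr rfl fun x _ => ?_
  calc _ = ∑ z : Fin n → a, ∑ y : Fin n → b, Y x y * ∏ i, ρ (z i, y i) (z i, x i) := by
        refine Finset.sum_congr rfl fun z _ => ?_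
        rw [← e.sum_comp, Fintype.sum_prod_type, Finset.sum_comm]
        refine Finset.sum_congr rfl fun y _ => ?_
        rw [Finset.sum_eq_single z]
        · rw [hT, one_apply_eq, one_mul]
          rfl
        · intro w _ hw
          rw [hT, one_apply_ne hw.symm, zero_mul, zero_mul]
        · simp
    _ = _ := by
        rw [Finset.sum_comm]
        refine Finset.sum_congr rfl fun y _ => ?_
        rw [← Finset.mul_sum, sum_prod_pi n fun i k => ρ (k, y i) (k, x i)]
        rfl

theorem isState_reducedA {a b : Type*} [Fintype a] [Fintype b]
    {ρ : Matrix (a × b) (a × b) ℂ} (hρ : IsState ρ) :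
    IsState (reducedA ρ) := by
  constructor
  · have : reducedA ρ = ∑ k, ρ.submatrix (fun i => (i, k)) fun i => (i, k) := by
      ext i j
      simp [reducedA, Matrix.sum_apply]
    rw [this]
    exact posSemidef_sum _ fun k _ => hρ.1.submatrix _
  · rw [← hρ.2]
    simp only [Matrix.trace, diag_apply, reducedA, of_apply, Fintype.sum_prod_type]

theorem isState_reducedB {a b : Type*} [Fintype a] [Fintype b]
    {ρ : Matrix (a × b) (a × b) ℂ} (hρ : IsState ρ) :
    IsState (reducedB ρ) := by
  constructor
  · have : reducedB ρ = ∑ k, ρ.submatrix (fun i => (k, i)) fun i => (k, i) := by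
      ext i j
      simp [reducedB, Matrix.sum_apply]
    rw [this]
    exact posSemidef_sum _ fun k _ => hρ.1.submatrix _
  · rw [← hρ.2]
    simp only [Matrix.trace, diag_apply, reducedB, of_apply, Fintype.sum_prod_type_right]

/-- A union bound: `(1 - P) ⊗ 1 + 1 ⊗ (1 - Q)` exceeds `1 - P ⊗ Q` by `(1 - P) ⊗ (1 - Q) ≥ 0`. -/
theorem trace_one_sub_tensorAB_le {ρ : Matrix (a × b) (a × b) ℂ} (hρ : IsState ρ)
    {P : Matrix (Fin n → a) (Fin n → a) ℂ} {Q : Matrix (Fin n → b) (Fin n → b) ℂ}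
    (hP : IsProjection P) (hQ : IsProjection Q) :
    ((1 - tensorAB P Q) * tensorPower ρ n).trace.re ≤
      ((1 - P) * tensorPower (reducedA ρ) n).trace.re +
        ((1 - Q) * tensorPower (reducedB ρ) n).trace.re := by
  rw [← trace_tensorAB_one_mul, ← trace_one_tensorAB_mul, ← Complex.add_re, ← Matrix.trace_add,
    ← Matrix.add_mul]
  refine trace_mul_re_mono_left ?_ (isState_tensorPower hρ n).1
  have h := posSemidef_tensorAB hP.one_sub.posSemidef hQ.one_sub.posSemidef
  rw [← tensorAB_one]
  convert h using 1
  simp only [tensorAB_sub_left, tensorAB_sub_right]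
  abel

theorem trace_tensorAB {a b : Type*} [Fintype a] [Fintype b] {n : ℕ}
    (A : Matrix (Fin n → a) (Fin n → a) ℂ) (B : Matrix (Fin n → b) (Fin n → b) ℂ) :
    (tensorAB A B).trace = A.trace * B.trace := by
  rw [← trace_kronecker, tensorAB_eq_kronecker]
  simp only [Matrix.trace, diag_apply, submatrix_apply]
  exact Equiv.sum_comp (Equiv.arrowProdEquivProdArrow (Fin n) (fun _ => a) fun _ => b)
    fun x => (kroneckerMap (· * ·) A B) x x

theorem isState_tensorAB {a b : Type*} [Fintype a] [Fintype b] {n : ℕ}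
    {σ : Matrix (Fin n → a) (Fin n → a) ℂ} {τ : Matrix (Fin n → b) (Fin n → b) ℂ}
    (hσ : IsState σ) (hτ : IsState τ) : IsState (tensorAB σ τ) :=
  ⟨posSemidef_tensorAB hσ.1 hτ.1, by rw [trace_tensorAB, hσ.2, hτ.2, one_mul]⟩

/-- It suffices to bound the type 2 error of a symmetrized test on products of two permutation
invariant states. -/
theorem trace_symmetrize_mul_tensorAB_le {M : Matrix (Fin n → a × b) (Fin n → a × b) ℂ} {c : ℝ}
    (h : ∀ (σ : Matrix (Fin n → a) (Fin n → a) ℂ) (τ : Matrix (Fin n → b) (Fin n → b) ℂ),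
      IsState σ → IsState τ → IsPermInvariant σ → IsPermInvariant τ →
        (M * tensorAB σ τ).trace.re ≤ c)
    {ω : Matrix (Fin n → a × b) (Fin n → a × b) ℂ} (hω : ω ∈ alternatives a b n) :
    (symmetrize M * ω).trace.re ≤ c := by
  obtain ⟨σ, τ, hσ, hτ, hinv, rfl⟩ := hω
  rw [trace_symmetrize_mul]
  rcases hinv with hinv | hinv
  -- Permutations act on both factors simultaneously; an invariant factor is unaffected, so the
  -- averaging falls on the other alone.
  · have : symmetrize (tensorAB σ τ) = tensorAB σ (symmetrize τ) := by
      ext x y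
      simp only [symmetrize, Matrix.smul_apply, Matrix.sum_apply, submatrix_apply, tensorAB,
        of_apply, smul_eq_mul]
      conv_rhs => rw [mul_left_comm, Finset.mul_sum]
      congr 1
      refine Finset.sum_congr rfl fun π _ => ?_
      nth_rewrite 2 [← isPermInvariant_iff.mp hinv π]
      rfl
    rw [this]
    exact h _ _ hσ (isState_symmetrize hτ) hinv (isPermInvariant_symmetrize τ)
  · have : symmetrize (tensorAB σ τ) = tensorAB (symmetrize σ) τ := by
      ext x y
      simp only [symmetrize, Matrix.smul_apply, Matrix.sum_apply, submatrix_apply, tensorAB,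
        of_apply, smul_eq_mul]
      conv_rhs => rw [mul_assoc, Finset.sum_mul]
      congr 1
      refine Finset.sum_congr rfl fun π _ => ?_
      nth_rewrite 2 [← isPermInvariant_iff.mp hinv π]
      rfl
    rw [this]
    exact h _ _ (isState_symmetrize hσ) hτ (isPermInvariant_symmetrize σ) hinv

end tensorAB

/-! ### Achievability -/

theorem tendsto_add_one_pow_mul_two_rpow_neg (k : ℕ) {δ : ℝ} (hδ : 0 < δ) :
    Tendsto (fun n : ℕ => ((n : ℝ) + 1) ^ k * (2 : ℝ) ^ (-(n * δ))) atTop (𝓝 0) := by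
  set r : ℝ := (2 : ℝ) ^ (-δ)
  have hr0 : 0 < r := by positivity
  have hr1 : r < 1 := Real.rpow_lt_one_of_one_lt_of_neg (by norm_num) (by linarith)
  have h := (tendsto_add_atTop_iff_nat 1).mpr
    (tendsto_pow_const_mul_const_pow_of_abs_lt_one k (r := r) (by rwa [abs_of_pos hr0]))
  have h2 := h.div_const r
  rw [zero_div] at h2
  refine h2.congr fun n => ?_
  have : (2 : ℝ) ^ (-(n * δ)) = r ^ n := by
    rw [← Real.rpow_natCast, ← Real.rpow_mul (by norm_num)]
    congr 1
    ring
  rw [this, pow_succ]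
  push_cast
  field_simp

/-- A projection that cuts off the large eigenvalues of the universal symmetric operator, and that
asymptotically preserves many copies of a given state. -/
theorem eventually_exists_universal_projection {ι : Type*} [Fintype ι] [DecidableEq ι]
    {ρ : Matrix ι ι ℂ} (hρ : IsState ρ) {δ η : ℝ} (hδ : 0 < δ) (hη : 0 < η) :
    ∀ᶠ n : ℕ in atTop, ∃ Q : Matrix (Fin n → ι) (Fin n → ι) ℂ, IsProjection Q ∧
      ((((2 : ℝ) ^ (-(n * (entropy ρ - 2 * δ))) : ℝ) : ℂ) • 1 -
        Q * universalMatrix ι n * Q).PosSemidef ∧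
      ((1 - Q) * tensorPower ρ n).trace.re ≤ η := by
  filter_upwards [eventually_exists_typical_projection hρ hδ (half_pos hη),
    (tendsto_add_one_pow_mul_two_rpow_neg (Fintype.card (ι × ι)) hδ).eventually_le_const
      (half_pos hη)] with n ⟨_, _, _, _, _, hP⟩ hn
  set t : ℝ := (2 : ℝ) ^ (-(n * (entropy ρ - 2 * δ))) with ht
  have ht0 : 0 < t := by positivity
  obtain ⟨Q, hQ, hQ1, hQ2⟩ := exists_spectral_projection (posSemidef_universalMatrix (ι := ι)
    (n := n)) ht0
  refine ⟨Q, hQ, hQ1, ?_⟩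
  -- The discarded subspace has dimension at most a polynomial times `2 ^ (n (H - 2 δ))`, while
  -- `ρ^{⊗n}` gives at most `2 ^ (-n (H - δ))` per dimension, up to `η / 2`.
  have h1 := hP (1 - Q) hQ.one_sub.posSemidef (by rw [sub_sub_cancel]; exact hQ.posSemidef)
  have h2 : (1 - Q).trace.re ≤ ((n : ℝ) + 1) ^ Fintype.card (ι × ι) / t :=
    hQ2.trans (div_le_div_of_nonneg_right trace_universalMatrix_le ht0.le)
  have h3 : (2 : ℝ) ^ (-(n * (entropy ρ - δ))) = t * 2 ^ (-(n * δ)) := by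
    rw [ht, ← Real.rpow_add (by norm_num)]
    congr 1
    ring
  have h4 : (2 : ℝ) ^ (-(n * (entropy ρ - δ))) * (1 - Q).trace.re ≤
      ((n : ℝ) + 1) ^ Fintype.card (ι × ι) * 2 ^ (-(n * δ)) := by
    refine (mul_le_mul_of_nonneg_left h2 (by positivity)).trans (le_of_eq ?_)
    rw [h3]
    field_simp
  linarith

variable {a b : Type*} [Fintype a] [DecidableEq a] [Fintype b] [DecidableEq b]
  {ρ : Matrix (a × b) (a × b) ℂ}

theorem eventually_exists_test (hρ : IsState ρ) {δ ε : ℝ} (hδ : 0 < δ) (hε : 0 < ε) :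
    ∀ᶠ n : ℕ in atTop, ∃ M ∈ tests ρ n ε, ∀ ω ∈ alternatives a b n,
      (M * ω).trace.re ≤ (2 : ℝ) ^ (-(n * (mutualInformation ρ - 5 * δ))) := by
  -- Error budget: `1 - Q` costs `2 η`, and compressing `1 - P` costs `2 η + 4 η`.
  have hη : 0 < ε / 8 := by positivity
  filter_upwards [eventually_exists_typical_projection hρ hδ hη,
    eventually_exists_universal_projection (isState_reducedA hρ) hδ hη,
    eventually_exists_universal_projection (isState_reducedB hρ) hδ hη]
    with n ⟨P, hP, hP1, hP2, _, _⟩ ⟨QA, hQA, hQA1, hQA2⟩ ⟨QB, hQB, hQB1, hQB2⟩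
  have hstate := isState_tensorPower hρ n
  set Q := tensorAB QA QB with hQdef
  have hQ : IsProjection Q := isProjection_tensorAB hQA hQB
  have hQ1 := trace_one_sub_tensorAB_le hρ hQA hQB
  rw [← hQdef] at hQ1
  have hX : (Q * P * Q).PosSemidef := compress_posSemidef hQ hP.posSemidef
  have hX1 : (1 - Q * P * Q).PosSemidef := one_sub_compress_posSemidef hQ hP.one_sub.posSemidef
  refine ⟨symmetrize (Q * P * Q), ⟨posSemidef_symmetrize hX, ?_, ?_⟩, fun ω hω => ?_⟩
  · rw [← symmetrize_eq_self isPermInvariant_one, ← symmetrize_sub]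
    exact posSemidef_symmetrize hX1
  · rw [trace_symmetrize_mul, symmetrize_eq_self (isPermInvariant_tensorPower ρ)]
    have h1 := trace_compress_le hQ hP.one_sub.posSemidef
      (by rw [sub_sub_cancel]; exact hP.posSemidef) hstate.1
    have h2 : Q * P * Q = 1 - (1 - Q) - Q * (1 - P) * Q := by
      rw [Matrix.mul_sub, Matrix.mul_one, Matrix.sub_mul, hQ.2]
      abel
    rw [h2, Matrix.sub_mul, Matrix.sub_mul, Matrix.trace_sub, Matrix.trace_sub, Matrix.one_mul,
      hstate.2, Complex.sub_re, Complex.sub_re, Complex.one_re]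
    linarith
  · refine trace_symmetrize_mul_tensorAB_le (fun σ τ hσ hτ hσi hτi => ?_) hω
    set tA : ℝ := (2 : ℝ) ^ (-(n * (entropy (reducedA ρ) - 2 * δ))) with htA
    set tB : ℝ := (2 : ℝ) ^ (-(n * (entropy (reducedB ρ) - 2 * δ))) with htB
    have hdom : (tensorAB (universalMatrix a n) (universalMatrix b n) -
        tensorAB σ τ).PosSemidef :=
      tensorAB_sub_posSemidef hσ.1 posSemidef_universalMatrix
        (universalMatrix_sub_posSemidef hσ hσi) (universalMatrix_sub_posSemidef hτ hτi)
    have hcut : (((tA * tB : ℝ) : ℂ) • 1 -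
        Q * tensorAB (universalMatrix a n) (universalMatrix b n) * Q).PosSemidef := by
      rw [hQdef, tensorAB_mul, tensorAB_mul, ← tensorAB_one, Complex.ofReal_mul,
        ← tensorAB_smul_smul]
      exact tensorAB_sub_posSemidef (compress_posSemidef hQA posSemidef_universalMatrix)
        (PosSemidef.one.smul (by exact_mod_cast (by positivity : 0 ≤ tB))) hQA1 hQB1
    calc (Q * P * Q * tensorAB σ τ).trace.re
        ≤ (Q * P * Q * tensorAB (universalMatrix a n) (universalMatrix b n)).trace.re :=
          trace_mul_re_mono_right hX hdom
      _ = (P * (Q * tensorAB (universalMatrix a n) (universalMatrix b n) * Q)).trace.re := by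
          rw [Matrix.mul_assoc, Matrix.mul_assoc, Matrix.trace_mul_comm, Matrix.mul_assoc]
      _ ≤ (P * (((tA * tB : ℝ) : ℂ) • 1)).trace.re :=
          trace_mul_re_mono_right hP.posSemidef hcut
      _ = tA * tB * P.trace.re := by
          rw [Matrix.mul_smul, Matrix.mul_one, trace_smul, smul_eq_mul, Complex.re_ofReal_mul]
      _ ≤ tA * tB * (2 : ℝ) ^ (n * (entropy ρ + δ)) :=
          mul_le_mul_of_nonneg_left hP2 (by positivity)
      _ = _ := by
          rw [htA, htB, ← Real.rpow_add (by norm_num), ← Real.rpow_add (by norm_num),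
            mutualInformation]
          congr 1
          ring

/-! ### Strong converse -/

theorem tensorAB_reduced_mem_alternatives (hρ : IsState ρ) (n : ℕ) :
    tensorAB (tensorPower (reducedA ρ) n) (tensorPower (reducedB ρ) n) ∈ alternatives a b n :=
  ⟨_, _, isState_tensorPower (isState_reducedA hρ) n, isState_tensorPower (isState_reducedB hρ) n,
    Or.inl (isPermInvariant_tensorPower _), rfl⟩

theorem eventually_le_trace_test (hρ : IsState ρ) {δ ε : ℝ} (hδ : 0 < δ) (hε : ε < 1) :
    ∀ᶠ n : ℕ in atTop, ∀ M ∈ tests ρ n ε,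
      (1 - ε) / 4 * (2 : ℝ) ^ (-(n * (mutualInformation ρ + 3 * δ))) ≤
        (M * tensorAB (tensorPower (reducedA ρ) n) (tensorPower (reducedB ρ) n)).trace.re := by
  -- Compression gives `1 - ε ≤ 2 (u tr[M Q] + η) + 4 η`; the `6 η` use up half of `1 - ε`.
  have hη : 0 < (1 - ε) / 12 := by linarith
  filter_upwards [eventually_exists_typical_projection hρ hδ hη,
    eventually_exists_typical_projection (isState_reducedA hρ) hδ hη,
    eventually_exists_typical_projection (isState_reducedB hρ) hδ hη]
    with n ⟨_, _, _, _, _, hP⟩ ⟨QA, hQA, hQA1, _, hQA3, _⟩ ⟨QB, hQB, hQB1, _, hQB3, _⟩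
  rintro M ⟨hM, hM1, hMε⟩
  have hstate := isState_tensorPower hρ n
  set Q := tensorAB QA QB with hQdef
  have hQ : IsProjection Q := isProjection_tensorAB hQA hQB
  have hQ1 := trace_one_sub_tensorAB_le hρ hQA hQB
  rw [← hQdef] at hQ1
  set sA : ℝ := (2 : ℝ) ^ (-(n * (entropy (reducedA ρ) + δ))) with hsA
  set sB : ℝ := (2 : ℝ) ^ (-(n * (entropy (reducedB ρ) + δ))) with hsB
  set u : ℝ := (2 : ℝ) ^ (-(n * (entropy ρ - δ))) with hu
  have hu0 : 0 < u := by positivity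
  have hsub : (tensorAB (tensorPower (reducedA ρ) n) (tensorPower (reducedB ρ) n) -
      ((sA * sB : ℝ) : ℂ) • Q).PosSemidef := by
    rw [hQdef, Complex.ofReal_mul, ← tensorAB_smul_smul]
    exact tensorAB_sub_posSemidef
      (hQA.posSemidef.smul (by exact_mod_cast (by positivity : 0 ≤ sA)))
      (isState_tensorPower (isState_reducedB hρ) n).1 hQA3 hQB3
  have h1 := trace_le_compress hQ hM hM1 hstate.1
  have h2 := hP (Q * M * Q) (compress_posSemidef hQ hM) (one_sub_compress_posSemidef hQ hM1)
  have h3 : (Q * M * Q).trace = (M * Q).trace := by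
    rw [Matrix.mul_assoc, Matrix.trace_mul_comm, Matrix.mul_assoc, hQ.2]
  have h4 : (1 - ε) / 4 ≤ u * (M * Q).trace.re := by
    rw [← h3]
    linarith
  have h5 : (2 : ℝ) ^ (-(n * (mutualInformation ρ + 3 * δ))) = sA * sB * u⁻¹ := by
    rw [hsA, hsB, hu, ← Real.rpow_neg (by norm_num), ← Real.rpow_add (by norm_num),
      ← Real.rpow_add (by norm_num), mutualInformation]
    congr 1
    ring
  calc _ ≤ u * (M * Q).trace.re * (2 : ℝ) ^ (-(n * (mutualInformation ρ + 3 * δ))) :=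
        mul_le_mul_of_nonneg_right h4 (by positivity)
    _ = (M * (((sA * sB : ℝ) : ℂ) • Q)).trace.re := by
        rw [h5, Matrix.mul_smul, trace_smul, smul_eq_mul, Complex.re_ofReal_mul]
        field_simp
    _ ≤ _ := trace_mul_re_mono_right hM hsub

/-! ### The error exponent -/

theorem trace_test_mul_le_typeTwoError {n : ℕ} {M : Matrix (Fin n → a × b) (Fin n → a × b) ℂ}
    (hM1 : (1 - M).PosSemidef) {ω : Matrix (Fin n → a × b) (Fin n → a × b) ℂ}
    (hω : ω ∈ alternatives a b n) : (M * ω).trace.re ≤ typeTwoError M := by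
  refine le_csSup ⟨1, ?_⟩ ⟨ω, hω, rfl⟩
  rintro _ ⟨_, ⟨σ, τ, hσ, hτ, -, rfl⟩, rfl⟩
  have h := isState_tensorAB hσ hτ
  refine (trace_mul_re_mono_left hM1 h.1).trans ?_
  rw [Matrix.one_mul, h.2, Complex.one_re]

theorem tendsto_errorExponent (hρ : IsState ρ) {ε : ℝ} (hε : ε ∈ Set.Ioo (0 : ℝ) 1) :
    Tendsto (fun n : ℕ => errorExponent ρ n ε) atTop (𝓝 (mutualInformation ρ)) := by
  rw [Metric.tendsto_nhds]
  intro κ hκ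
  set I := mutualInformation ρ
  obtain ⟨δ, hδ, hδκ⟩ : ∃ δ, 0 < δ ∧ 5 * δ < κ := ⟨κ / 10, by positivity, by linarith⟩
  have hc : 0 < (1 - ε) / 4 := by linarith [hε.2]
  filter_upwards [eventually_exists_test hρ hδ hε.1, eventually_le_trace_test hρ hδ hε.2,
    -- With exponent `0` this says that `2 ^ (-n δ)` drops below `(1 - ε) / 4`, so one more `δ`
    -- absorbs the constant of the converse.
    (tendsto_add_one_pow_mul_two_rpow_neg 0 hδ).eventually_le_const hc, eventually_gt_atTop 0]
    with n ⟨M, hM, hMω⟩ hlow hn hn0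
  have hn0' : (0 : ℝ) < n := by exact_mod_cast hn0
  rw [pow_zero, one_mul] at hn
  set m := sInf (typeTwoError '' tests ρ n ε) with hm
  have hupper : m ≤ (2 : ℝ) ^ (-(n * (I - 5 * δ))) := by
    refine (csInf_le ⟨0, ?_⟩ (Set.mem_image_of_mem _ hM)).trans (Real.sSup_le ?_ (by positivity))
    · rintro _ ⟨N, hN, rfl⟩
      refine Real.sSup_nonneg ?_
      rintro _ ⟨_, ⟨σ, τ, hσ, hτ, -, rfl⟩, rfl⟩
      exact trace_mul_re_nonneg hN.1 (isState_tensorAB hσ hτ).1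
    · rintro _ ⟨ω, hω, rfl⟩
      exact hMω ω hω
  have hlower : (2 : ℝ) ^ (-(n * (I + 4 * δ))) ≤ m := by
    have : (2 : ℝ) ^ (-(n * (I + 4 * δ))) = 2 ^ (-(n * δ)) * 2 ^ (-(n * (I + 3 * δ))) := by
      rw [← Real.rpow_add (by norm_num)]
      congr 1
      ring
    rw [this]
    refine (mul_le_mul_of_nonneg_right hn (by positivity)).trans
      (le_csInf (Set.Nonempty.image _ (Set.nonempty_of_mem hM)) ?_)
    rintro _ ⟨N, hN, rfl⟩
    exact (hlow N hN).trans
      (trace_test_mul_le_typeTwoError hN.2.1 (tensorAB_reduced_mem_alternatives hρ n))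
  have hm0 : 0 < m := lt_of_lt_of_le (by positivity) hlower
  rw [← Real.logb_le_iff_le_rpow (by norm_num) hm0] at hupper
  rw [← Real.le_logb_iff_rpow_le (by norm_num) hm0] at hlower
  have he : errorExponent ρ n ε = -Real.logb 2 m / n := by
    rw [errorExponent, ← hm]
    ring
  rw [he, Real.dist_eq, abs_lt, lt_sub_iff_add_lt, sub_lt_iff_lt_add, lt_div_iff₀ hn0',
    div_lt_iff₀ hn0']
  constructor <;> nlinarith

end QuantumTesting

end

theorem mainTheorem5 {a b : Type*} [Fintype a] [DecidableEq a] [Fintype b] [DecidableEq b]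
    (ρ : Matrix (a × b) (a × b) ℂ) (hρ : QuantumTesting.IsState ρ) :
    ∃ ζ : ℝ → ℝ,
      (∀ ε ∈ Set.Ioo (0 : ℝ) 1,
        Tendsto (fun n : ℕ => QuantumTesting.errorExponent ρ n ε) atTop (𝓝 (ζ ε))) ∧
      Tendsto ζ (𝓝[>] 0) (𝓝 (QuantumTesting.mutualInformation ρ)) :=
  -- By the strong converse the limit does not depend on `ε`, so a constant function serves.
  ⟨fun _ => QuantumTesting.mutualInformation ρ,
    fun _ hε => QuantumTesting.tendsto_errorExponent hρ hε, tendsto_const_nhds⟩
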